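/- Let $\mathcal S=(\mathcal X,\mathcal Y,Act,\{M_a\}_{a\in Act})$ be a mechanism: $\mathcal X$ (secrets), $\mathcal Y$ (observations) and $Act$ (actions) are finite non-empty sets and each $M_a$ is a stochastic $\mathcal X\times\mathcal Y$ matrix with entries $p_a(y|x)$. Let $\mathcal P$ be the simplex of probability distributions on $\mathcal X$, let $U:\mathcal P\to\mathbb R$ be concave and continuous, and let $p\in\mathcal P$ (the prior, the law of the secret $X$). A strategy is a partial function $\sigma:\mathcal Y^*\to Act$ with non-empty prefix-closed domain; it is finite if its domain is finite and infinite otherwise, total if its domain is $\mathcal Y^*$, and non-adaptive if $\sigma(v)=\sigma(w)$ (as partial functions) whenever $|v|=|w|$. Its truncation $\sigma\backslash l$ is its restriction to sequences of length at most $l$. For a strategy $\sigma$, a secret $x$ and $w=y_1\cdots y_n$ with $n\ge 1$, put $p_\sigma(w|x)=\prod_{i=1}^n p_{a_i}(y_i|x)$ with $a_i=\sigma(y_1\cdots y_{i-1})$ if $y_1\cdots y_{n-1}\in\mathrm{dom}(\sigma)$ and $w\notin\mathrm{dom}(\sigma)$; put $p_\sigma(w|x)=0$ for all other $w\in\mathcal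 Y^*$. Write $p_\sigma(x,w)=p(x)\,p_\sigma(w|x)$, $p_\sigma(w)=\sum_x p_\sigma(x,w)$ and $p_\sigma(x|w)=p_\sigma(x,w)/p_\sigma(w)$. The leakage of a finite strategy is $$I_\sigma(\mathcal S,p)=U(p)-\sum_{w:\,p_\sigma(w)>0}p_\sigma(w)\,U(p_\sigma(\cdot|w)),$$ that of an infinite strategy is $I_\sigma(\mathcal S,p)=\lim_{l\to\infty}I_{\sigma\backslash l}(\mathcal S,p)$, and $I_\star(\mathcal S,p)=\sup_\sigma I_\sigma(\mathcal S,p)$ over all strategies, finite or infinite. Call $x,x'\in\mathcal X$ indistinguishable, $x\equiv x'$, if $p_\sigma(\cdot|x)=p_\sigma(\cdot|x')$ for every finite strategy $\sigma$; let $[X]$ be the $\equiv$-class of $X$. For a class $c$ let $p(c)=\sum_{x\in c}p(x)$ and, if $p(c)>0$, let $p(\cdot|c)$ be the distribution equal to $p(x)/p(c)$ for $x\in c$ and $0$ elsewhere. Put $$I(X;[X])=U(p)-\sum_{c:\,p(c)>0}p(c)\,U(p(\cdot|c)).$$ Theorem. The limit defining the leakage of an infinite strategy always exists. There is a total, non-adaptive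 strategy $\sigma$ with $I_\sigma(\mathcal S,p)=I(X;[X])$; indeed, for every enumeration $a_1,\dots,a_k$ of $Act$ without repetition, the strategy $\sigma(y_1\cdots y_j)=a_{(j\bmod k)+1}$ that cycles through all actions forever is total and non-adaptive and has this leakage. Consequently the maximum leakage over all strategies is attained, and $I_\star(\mathcal S,p)=I(X;[X])$. -/

import Mathlib

namespace QIF

/-- An action-based randomization mechanism with secrets `X`, observations `Y` and actions `Act`:
a stochastic matrix `M a` for every action, whose entry `M a x y` is `p_a(y|x)`. -/
structure Mechanism (X Y Act : Type*) [Fintype Y] where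
  M : Act → Matrix X Y ℝ
  stochastic : ∀ a x, M a x ∈ stdSimplex ℝ Y

/-- An uncertainty measure: a concave and continuous real function on the simplex of all
probability distributions on `X` (its values outside the simplex play no role). -/
structure IsUncertainty {X : Type*} [Fintype X] (U : (X → ℝ) → ℝ) : Prop where
  concave : ConcaveOn ℝ (stdSimplex ℝ X) U
  continuous : ContinuousOn U (stdSimplex ℝ X)

/-- A strategy: a partial function from finite sequences of observations to actions with non-empty,
prefix-closed domain. The value `none` means undefined. -/
structure Strategy (Y Act : Type*) where
  act : List Y → Option Act
  dom_nonempty : {w | (act w).isSome}.Nonempty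
  prefix_closed : ∀ v w : List Y, v <+: w → (act w).isSome → (act v).isSome

namespace Strategy

variable {Y Act : Type*}

def dom (σ : Strategy Y Act) : Set (List Y) := {w | (σ.act w).isSome}

/-- A strategy is finite if its domain is; otherwise it is infinite. -/
def IsFinite (σ : Strategy Y Act) : Prop := σ.dom.Finite

def IsTotal (σ : Strategy Y Act) : Prop := σ.dom = Set.univ

/-- The next action depends only on the number of past observations. -/
def NonAdaptive (σ : Strategy Y Act) : Prop :=
  ∀ v w : List Y, v.length = w.length → σ.act v = σ.act w

theorem act_nil_isSome (σ : Strategy Y Act) : (σ.act []).isSome := by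
  obtain ⟨w, hw⟩ := σ.dom_nonempty
  exact σ.prefix_closed [] w List.nil_prefix hw

/-- The truncation at level `n`: the restriction to sequences of length at most `n`. -/
def truncate (σ : Strategy Y Act) (n : ℕ) : Strategy Y Act where
  act w := if w.length ≤ n then σ.act w else none
  dom_nonempty := ⟨[], by simpa using σ.act_nil_isSome⟩
  prefix_closed := by
    intro v w hvw hw
    by_cases h : w.length ≤ n
    · have hv : v.length ≤ n := hvw.length_le.trans h
      simp only [h, hv, if_true] at hw ⊢
      exact σ.prefix_closed v w hvw hw
    · simp [h] at hw

/-- The strategy `[a₁, …, a_k, a₁, …, a_k, …]` that repeats forever, in the same order, an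
enumeration of all the actions. -/
def cyclic [Fintype Act] [Nonempty Act] (e : Fin (Fintype.card Act) ≃ Act) : Strategy Y Act where
  act w := some (e ⟨w.length % Fintype.card Act, Nat.mod_lt _ Fintype.card_pos⟩)
  dom_nonempty := ⟨[], rfl⟩
  prefix_closed := fun _ _ _ _ => rfl

/-- `w` is a sequence of observations with which a play of `σ` terminates:
`w = y₁ … y_j y_{j+1}` with `y₁ … y_j` in the domain and `w` outside it. -/
def Terminates (σ : Strategy Y Act) (w : List Y) : Prop :=
  w ≠ [] ∧ w.dropLast ∈ σ.dom ∧ w ∉ σ.dom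

end Strategy

section

variable {X Y Act : Type*} [Fintype X] [Fintype Y]

/-- `p_σ(w|x)`: for `w = y₁ … y_n` terminating a play of `σ` it is the product of the
`p_{a_i}(y_i|x)`, where `a_i = σ(y₁ … y_{i-1})`; otherwise it is `0`. -/
noncomputable def likelihood (S : Mechanism X Y Act) (σ : Strategy Y Act) (x : X) (w : List Y) :
    ℝ :=
  open Classical in
  if σ.Terminates w then
    ∏ i : Fin w.length, (σ.act (w.take i)).elim 0 (fun a => S.M a x (w.get i))
  else 0

/-- The joint probability `p_σ(x, w)` of the secret and the observations. -/
noncomputable def joint (S : Mechanism X Y Act) (p : X → ℝ) (σ : Strategy Y Act) (x : X)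
    (w : List Y) : ℝ :=
  p x * likelihood S σ x w

/-- `p_σ(w) = Pr(Y = w)`. -/
noncomputable def obsProb (S : Mechanism X Y Act) (p : X → ℝ) (σ : Strategy Y Act) (w : List Y) :
    ℝ :=
  ∑ x, joint S p σ x w

/-- The posterior distribution `p_σ(· | w)` of the secret (used where `p_σ(w) > 0`). -/
noncomputable def posterior (S : Mechanism X Y Act) (p : X → ℝ) (σ : Strategy Y Act) (w : List Y) :
    X → ℝ :=
  fun x => joint S p σ x w / obsProb S p σ w

/-- `U_σ(X|Y)`, for finite `σ`: the sum ranges over the finitely many `w` with `p_σ(w) > 0`. -/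
noncomputable def condUncertainty (S : Mechanism X Y Act) (U : (X → ℝ) → ℝ) (p : X → ℝ)
    (σ : Strategy Y Act) : ℝ :=
  ∑ᶠ (w : List Y) (_ : 0 < obsProb S p σ w), obsProb S p σ w * U (posterior S p σ w)

/-- The information gain `I_σ(X;Y) = U(X) - U_σ(X|Y)`, for finite `σ`. -/
noncomputable def infoGain (S : Mechanism X Y Act) (U : (X → ℝ) → ℝ) (p : X → ℝ)
    (σ : Strategy Y Act) : ℝ :=
  U p - condUncertainty S U p σ

/-- The leakage `I_σ(S,p)`: the information gain if `σ` is finite, and the limit of the information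
gains of the truncations of `σ` if it is infinite. -/
noncomputable def leakage (S : Mechanism X Y Act) (U : (X → ℝ) → ℝ) (p : X → ℝ)
    (σ : Strategy Y Act) : ℝ :=
  open Classical in
  if σ.IsFinite then infoGain S U p σ
  else Filter.limUnder Filter.atTop (fun l : ℕ => infoGain S U p (σ.truncate l))

/-- `I_⋆(S,p)`: the supremum of the leakage over all strategies. -/
noncomputable def maxLeakage (S : Mechanism X Y Act) (U : (X → ℝ) → ℝ) (p : X → ℝ) : ℝ :=
  ⨆ σ : Strategy Y Act, leakage S U p σ

/-- Indistinguishability of secrets: no finite strategy tells them apart. -/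
def indist (S : Mechanism X Y Act) : Setoid X where
  r x x' := ∀ σ : Strategy Y Act, σ.IsFinite → likelihood S σ x = likelihood S σ x'
  iseqv := ⟨fun _ _ _ => rfl, fun h σ hσ => (h σ hσ).symm,
    fun h h' σ hσ => (h σ hσ).trans (h' σ hσ)⟩

/-- `p(c) = Pr([X] = c)` for an indistinguishability class `c`. -/
noncomputable def classProb (S : Mechanism X Y Act) (p : X → ℝ) (c : Quotient (indist S)) : ℝ :=
  open Classical in
  ∑ x, if Quotient.mk (indist S) x = c then p x else 0

/-- `p(· | [X] = c)`: it is `p(x) / p(c)` for `x` in `c` and `0` elsewhere (used where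
`p(c) > 0`). -/
noncomputable def classPosterior (S : Mechanism X Y Act) (p : X → ℝ) (c : Quotient (indist S)) :
    X → ℝ :=
  open Classical in
  fun x => if Quotient.mk (indist S) x = c then p x / classProb S p c else 0

/-- `I(X;[X]) = U(X) - U(X|[X])`, where `U(X|[X])` is the sum of `p(c) U(p(·|c))` over the finitely
many classes `c` with `p(c) > 0`. -/
noncomputable def classInfo (S : Mechanism X Y Act) (U : (X → ℝ) → ℝ) (p : X → ℝ) : ℝ :=
  U p - ∑ᶠ (c : Quotient (indist S)) (_ : 0 < classProb S p c),
    classProb S p c * U (classPosterior S p c)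

end

end QIF

/-! Extend `U` to `perspective U q = |q| U(q/|q|)` on nonnegative vectors, where `|q|` is the total
mass; concavity becomes superadditivity. Stopping `σ` after `n` actions leaves the uncertainty `∑ w,
perspective U (p(·) p_σ(w|·))`, summed over the leaves `w` of a tree. Growing the tree splits
vectors, so this sum decreases (`remainingUncertainty_antitone`).

Upper bound on leakage: at a leaf the likelihood is constant on each class `c`, so the part of the
joint vector in `c` is a multiple of `p` restricted to `c`. Summing over leaves restores that
restriction, and superadditivity over classes gives `classUncertainty_le`. Monotonicity and this
bound make the limits exist.

Attainment: splitting a vector `q` along classes costs at most `ε |q|` plus a constant times the sum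
of `√(q x q x')` over inequivalent pairs (`exists_perspective_le_sum_indicator`). Summed over
leaves, these terms are weighted Bhattacharyya coefficients. Cycling repeats an action separating
`x` from `x'` forever, multiplying their coefficient by a fixed factor `< 1` each time, so it tends
to `0` (`tendsto_affinity_cyclic`). -/

namespace QIF

/-! ### Homogeneous extension of an uncertainty measure -/

section Perspective

variable {X : Type*} [Fintype X]

/-- The positively homogeneous extension of a function on the simplex to the positive orthant. -/
noncomputable def perspective (U : (X → ℝ) → ℝ) (q : X → ℝ) : ℝ :=
  (∑ x, q x) * U (fun x => q x / ∑ x, q x)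

theorem div_sum_mem_stdSimplex {q : X → ℝ} (hq : 0 ≤ q) (hs : ∑ x, q x ≠ 0) :
    (fun x => q x / ∑ x, q x) ∈ stdSimplex ℝ X :=
  ⟨fun x => div_nonneg (hq x) (Finset.sum_nonneg fun x _ => hq x), by
    rw [← Finset.sum_div, div_self hs]⟩

theorem eq_zero_of_sum_eq_zero {q : X → ℝ} (hq : 0 ≤ q) (hs : ∑ x, q x = 0) : q = 0 := by
  funext x
  exact (Finset.sum_eq_zero_iff_of_nonneg fun x _ => hq x).1 hs x (Finset.mem_univ x)

@[simp] theorem perspective_zero (U : (X → ℝ) → ℝ) : perspective U 0 = 0 := by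
  simp [perspective]

theorem perspective_smul (U : (X → ℝ) → ℝ) (t : ℝ) (q : X → ℝ) :
    perspective U (t • q) = t * perspective U q := by
  rcases eq_or_ne t 0 with rfl | ht
  · simp
  · simp only [perspective, Pi.smul_apply, smul_eq_mul, ← Finset.mul_sum,
      mul_div_mul_left _ _ ht, mul_assoc]

/-- Normalising `a + b` gives the mixture of the normalised `a` and `b` with weights proportional to
their masses, so this is concavity times the total mass. -/
theorem IsUncertainty.perspective_add {U : (X → ℝ) → ℝ} (hU : IsUncertainty U) {a b : X → ℝ}
    (ha : 0 ≤ a) (hb : 0 ≤ b) : perspective U a + perspective U b ≤ perspective U (a + b) := by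
  by_cases has : ∑ x, a x = 0
  · simp [eq_zero_of_sum_eq_zero ha has]
  by_cases hbs : ∑ x, b x = 0
  · simp [eq_zero_of_sum_eq_zero hb hbs]
  have hapos : 0 < ∑ x, a x := (Finset.sum_nonneg fun x _ => ha x).lt_of_ne' has
  have hbpos : 0 < ∑ x, b x := (Finset.sum_nonneg fun x _ => hb x).lt_of_ne' hbs
  have key := hU.concave.2 (div_sum_mem_stdSimplex ha has) (div_sum_mem_stdSimplex hb hbs)
    (show 0 ≤ (∑ x, a x) / (∑ x, a x + ∑ x, b x) by positivity)
    (show 0 ≤ (∑ x, b x) / (∑ x, a x + ∑ x, b x) by positivity) (by field_simp)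
  have hmix : ((∑ x, a x) / (∑ x, a x + ∑ x, b x)) • (fun x => a x / ∑ x, a x) +
      ((∑ x, b x) / (∑ x, a x + ∑ x, b x)) • (fun x => b x / ∑ x, b x) =
      fun x => (a + b) x / ∑ x, (a + b) x := by
    funext x
    simp only [Pi.add_apply, Pi.smul_apply, smul_eq_mul, Finset.sum_add_distrib]
    field_simp
  rw [hmix] at key
  have := mul_le_mul_of_nonneg_left key (add_pos hapos hbpos).le
  simp only [perspective]
  rw [show ∑ x, (a + b) x = ∑ x, a x + ∑ x, b x from Finset.sum_add_distrib] at this ⊢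
  refine le_trans (le_of_eq ?_) this
  simp only [smul_eq_mul]
  field_simp

theorem IsUncertainty.sum_perspective_le {U : (X → ℝ) → ℝ} (hU : IsUncertainty U) {ι : Type*}
    (s : Finset ι) (f : ι → X → ℝ) (hf : ∀ i, 0 ≤ f i) :
    ∑ i ∈ s, perspective U (f i) ≤ perspective U (∑ i ∈ s, f i) := by
  classical
  induction s using Finset.induction_on with
  | empty => simp
  | insert i s hi ih =>
    rw [Finset.sum_insert hi, Finset.sum_insert hi]
    exact (add_le_add_right ih _).trans
      (hU.perspective_add (hf i) (Finset.sum_nonneg fun j _ => hf j))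

theorem IsUncertainty.exists_bound {U : (X → ℝ) → ℝ} (hU : IsUncertainty U) :
    ∃ B, 0 ≤ B ∧ ∀ q ∈ stdSimplex ℝ X, |U q| ≤ B := by
  obtain ⟨B, hB⟩ := (isCompact_stdSimplex ℝ X).exists_bound_of_continuousOn hU.continuous
  exact ⟨max B 0, le_max_right _ _, fun q hq => (hB q hq).trans (le_max_left _ _)⟩

theorem abs_perspective_le {U : (X → ℝ) → ℝ} {B : ℝ} (hB : ∀ q ∈ stdSimplex ℝ X, |U q| ≤ B)
    {q : X → ℝ} (hq : 0 ≤ q) : |perspective U q| ≤ B * ∑ x, q x := by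
  by_cases hs : ∑ x, q x = 0
  · simp [eq_zero_of_sum_eq_zero hq hs]
  · have hpos : 0 ≤ ∑ x, q x := Finset.sum_nonneg fun x _ => hq x
    rw [perspective, abs_mul, abs_of_nonneg hpos, mul_comm]
    exact mul_le_mul_of_nonneg_right (hB _ (div_sum_mem_stdSimplex hq hs)) hpos

/-- A continuous function on the simplex is Lipschitz up to an arbitrarily small additive error. -/
theorem IsUncertainty.exists_le_add {U : (X → ℝ) → ℝ} (hU : IsUncertainty U) {ε : ℝ}
    (hε : 0 < ε) : ∃ C, 0 ≤ C ∧ ∀ q ∈ stdSimplex ℝ X, ∀ r ∈ stdSimplex ℝ X,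
      U q ≤ U r + ε + C * ∑ x, |q x - r x| := by
  obtain ⟨B, hB0, hB⟩ := hU.exists_bound
  obtain ⟨δ, hδ, h⟩ := Metric.uniformContinuousOn_iff.1
    ((isCompact_stdSimplex ℝ X).uniformContinuousOn_of_continuous hU.continuous) ε hε
  -- At distance at least `δ` the trivial bound `U q - U r ≤ 2B` is absorbed by the linear term; at
  -- smaller distance uniform continuity gives `ε`.
  refine ⟨2 * B / δ, by positivity, fun q hq r hr => ?_⟩
  have hD : 0 ≤ ∑ x, |q x - r x| := Finset.sum_nonneg fun x _ => abs_nonneg _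
  have hdist : dist q r ≤ ∑ x, |q x - r x| := (dist_pi_le_iff hD).2 fun x =>
    Finset.single_le_sum (f := fun x => |q x - r x|) (fun x _ => abs_nonneg _) (Finset.mem_univ x)
  rcases lt_or_ge (dist q r) δ with hlt | hge
  · have := (le_abs_self _).trans_lt (h q hq r hr hlt)
    have : 0 ≤ 2 * B / δ * ∑ x, |q x - r x| := by positivity
    linarith
  · have h1 : 2 * B ≤ 2 * B / δ * ∑ x, |q x - r x| := by
      rw [div_mul_eq_mul_div, le_div_iff₀ hδ]
      exact mul_le_mul_of_nonneg_left (hge.trans hdist) (by positivity)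
    have h2 := (abs_le.1 (hB q hq)).2
    have h3 := (abs_le.1 (hB r hr)).1
    linarith

theorem IsUncertainty.exists_perspective_le_add {U : (X → ℝ) → ℝ} (hU : IsUncertainty U) {ε : ℝ}
    (hε : 0 < ε) : ∃ C, 0 ≤ C ∧ ∀ a b : X → ℝ, 0 ≤ a → 0 ≤ b →
      perspective U a ≤ perspective U b + ε * ∑ x, b x + C * ∑ x, |a x - b x| := by
  obtain ⟨B, hB0, hB⟩ := hU.exists_bound
  obtain ⟨C, hC0, hC⟩ := hU.exists_le_add hε
  -- With hats for normalisation, `|a| U(â) - |b| U(b̂) = (|a| - |b|) U(â) + |b| (U(â) - U(b̂))`.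
  -- The first term costs `B D`; the second costs `ε |b| + 2 C D`.
  refine ⟨B + 2 * C, by positivity, fun a b ha hb => ?_⟩
  have hA := abs_le.1 (abs_perspective_le hB ha)
  have hB' := abs_le.1 (abs_perspective_le hB hb)
  set D := ∑ x, |a x - b x| with hDdef
  have hD : 0 ≤ D := Finset.sum_nonneg fun x _ => abs_nonneg _
  have hsub : |∑ x, a x - ∑ x, b x| ≤ D := by
    rw [← Finset.sum_sub_distrib]
    exact Finset.abs_sum_le_sum_abs _ _
  have hapos : 0 ≤ ∑ x, a x := Finset.sum_nonneg fun x _ => ha x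
  have hbpos : 0 ≤ ∑ x, b x := Finset.sum_nonneg fun x _ => hb x
  have hCD : 0 ≤ C * D := mul_nonneg hC0 hD
  by_cases has : ∑ x, a x = 0
  · have h1 : B * ∑ x, b x ≤ B * D := by
      refine mul_le_mul_of_nonneg_left ?_ hB0
      rw [has] at hsub
      simpa [abs_of_nonneg hbpos] using hsub
    have h2 := mul_nonneg hε.le hbpos
    rw [has] at hA
    linarith
  by_cases hbs : ∑ x, b x = 0
  · have h1 : B * ∑ x, a x ≤ B * D := by
      refine mul_le_mul_of_nonneg_left ?_ hB0
      rw [hbs] at hsub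
      simpa [abs_of_nonneg hapos] using hsub
    rw [hbs] at hB' ⊢
    linarith
  have hma := div_sum_mem_stdSimplex ha has
  have hmb := div_sum_mem_stdSimplex hb hbs
  have h1 : (∑ x, b x) * ∑ x, |a x / ∑ x, a x - b x / ∑ x, b x| ≤ 2 * D := by
    have hpt : ∀ x, (∑ x, b x) * |a x / ∑ x, a x - b x / ∑ x, b x| ≤
        a x / (∑ x, a x) * |∑ x, a x - ∑ x, b x| + |a x - b x| := by
      intro x
      calc (∑ x, b x) * |a x / ∑ x, a x - b x / ∑ x, b x|
          = |(∑ x, b x) * (a x / ∑ x, a x - b x / ∑ x, b x)| := by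
            rw [abs_mul, abs_of_nonneg hbpos]
        _ = |-(a x / (∑ x, a x) * (∑ x, a x - ∑ x, b x)) + (a x - b x)| := by
            congr 1; field_simp; ring
        _ ≤ _ := by
            refine (abs_add_le _ _).trans ?_
            rw [abs_neg, abs_mul, abs_of_nonneg (hma.1 x)]
    rw [Finset.mul_sum]
    refine (Finset.sum_le_sum fun x _ => hpt x).trans ?_
    rw [Finset.sum_add_distrib, ← Finset.sum_mul, hma.2]
    linarith
  have h2 := mul_le_mul_of_nonneg_left (hC _ hma _ hmb) hbpos
  have h3 : (∑ x, a x - ∑ x, b x) * U (fun x => a x / ∑ x, a x) ≤ D * B := by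
    refine (le_abs_self _).trans ?_
    rw [abs_mul]
    exact mul_le_mul hsub (hB _ hma) (abs_nonneg _) hD
  have h4 := mul_le_mul_of_nonneg_left h1 hC0
  simp only [perspective]
  linarith

/-- Splitting a measure along a partition `κ` loses little uncertainty if the parts of the
partition are nearly mutually singular. -/
theorem IsUncertainty.exists_perspective_le_sum_indicator [Nonempty X] {U : (X → ℝ) → ℝ}
    (hU : IsUncertainty U) {ι : Type*} [Fintype ι] (κ : X → ι) {ε : ℝ} (hε : 0 < ε) :
    ∃ C, 0 ≤ C ∧ ∀ q : X → ℝ, 0 ≤ q →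
      perspective U q ≤ ∑ c, perspective U ((κ ⁻¹' {c}).indicator q) + ε * ∑ x, q x +
        C * ∑ x, ∑ x', {x' | κ x ≠ κ x'}.indicator (fun x' => √(q x * q x')) x' := by
  classical
  obtain ⟨B, hB0, hB⟩ := hU.exists_bound
  obtain ⟨C, hC0, hC⟩ := hU.exists_perspective_le_add hε
  -- The part containing a heaviest point `x₀` is kept. The mass `E` outside it satisfies `E ≤ ∑ √(q
  -- x q x₀)` over those `x`, since `q x ≤ q x₀`. Discarding it costs `C E`, and the other parts
  -- contribute at least `-B E`.
  refine ⟨B + C, by positivity, fun q hq => ?_⟩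
  obtain ⟨x₀, hx₀⟩ := Finite.exists_max q
  have hind : ∀ c, 0 ≤ (κ ⁻¹' {c}).indicator q := fun c =>
    Set.indicator_nonneg fun x _ => hq x
  set E := ∑ x, if κ x = κ x₀ then 0 else q x with hE
  have hE_le : E ≤ ∑ x, ∑ x', {x' | κ x ≠ κ x'}.indicator (fun x' => √(q x * q x')) x' := by
    refine Finset.sum_le_sum fun x _ => ?_
    have hnn : ∀ x' ∈ Finset.univ,
        0 ≤ {x' | κ x ≠ κ x'}.indicator (fun x' => √(q x * q x')) x' := fun x' _ =>
      Set.indicator_nonneg (fun _ _ => Real.sqrt_nonneg _) _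
    split_ifs with h
    · exact Finset.sum_nonneg hnn
    · refine le_trans ?_ (Finset.single_le_sum hnn (Finset.mem_univ x₀))
      rw [Set.indicator_of_mem (show x₀ ∈ {x' | κ x ≠ κ x'} from h)]
      exact Real.le_sqrt_of_sq_le (by
        rw [sq]; exact mul_le_mul_of_nonneg_left (hx₀ x) (hq x))
  have h1 := hC q _ hq (hind (κ x₀))
  have h2 : ∑ x, |q x - (κ ⁻¹' {κ x₀}).indicator q x| = E := by
    refine Finset.sum_congr rfl fun x _ => ?_
    by_cases h : κ x = κ x₀
    · simp [h]
    · simp [h, abs_of_nonneg (show 0 ≤ q x from hq x)]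
  have h3 : ∑ x, (κ ⁻¹' {κ x₀}).indicator q x ≤ ∑ x, q x :=
    Finset.sum_le_sum fun x _ => Set.indicator_le_self' (fun _ _ => hq _) x
  have h4 : -(B * E) ≤
      ∑ c ∈ Finset.univ.erase (κ x₀), perspective U ((κ ⁻¹' {c}).indicator q) := by
    have hsum : E = ∑ c ∈ Finset.univ.erase (κ x₀), ∑ x, (κ ⁻¹' {c}).indicator q x := by
      rw [Finset.sum_comm]
      refine Finset.sum_congr rfl fun x _ => ?_
      simp only [Set.indicator_apply, Set.mem_preimage, Set.mem_singleton_iff,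
        Finset.sum_ite_eq, Finset.mem_erase, Finset.mem_univ, and_true, ne_eq, ite_not]
    rw [hsum, Finset.mul_sum, ← Finset.sum_neg_distrib]
    exact Finset.sum_le_sum fun c _ => (abs_le.1 (abs_perspective_le hB (hind c))).1
  rw [← Finset.add_sum_erase _ _ (Finset.mem_univ (κ x₀))]
  have h5 := mul_le_mul_of_nonneg_left h3 hε.le
  have h6 := mul_le_mul_of_nonneg_left hE_le (add_nonneg hB0 hC0)
  rw [h2] at h1
  linarith

end Perspective

/-! ### Truncations and the tree of stopped plays -/

namespace Strategy

variable {Y Act : Type*}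

theorem mem_dom_truncate (σ : Strategy Y Act) {l : ℕ} {w : List Y} :
    w ∈ (σ.truncate l).dom ↔ w ∈ σ.dom ∧ w.length ≤ l := by
  by_cases h : w.length ≤ l <;> simp [dom, truncate, h]

theorem IsFinite.exists_truncate_eq {σ : Strategy Y Act} (h : σ.IsFinite) :
    ∃ l, σ.truncate l = σ := by
  obtain ⟨l, hl⟩ := (h.image List.length).bddAbove
  refine ⟨l, ?_⟩
  have hact : (σ.truncate l).act = σ.act := by
    funext w
    simp only [truncate]
    split_ifs with hw
    · rfl
    · by_contra hne
      exact hw (hl ⟨w, Option.isSome_iff_ne_none.2 (Ne.symm hne), rfl⟩)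
  cases σ
  simpa [truncate] using hact

variable [Fintype Y]

open Classical in
/-- The observation sequences of the plays of `σ` that are stopped after at most `n` actions. -/
noncomputable def leaves (σ : Strategy Y Act) : ℕ → Finset (List Y)
  | 0 => {[]}
  | n + 1 => (σ.leaves n).biUnion fun w =>
      if w ∈ σ.dom then Finset.univ.image fun y => w ++ [y] else {w}

theorem mem_leaves (σ : Strategy Y Act) {n : ℕ} {w : List Y} :
    w ∈ σ.leaves n ↔
      (w = [] ∨ w.dropLast ∈ σ.dom) ∧ w.length ≤ n ∧ (w ∈ σ.dom → w.length = n) := by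
  classical
  induction n generalizing w with
  | zero =>
    simp only [leaves, Finset.mem_singleton]
    constructor
    · rintro rfl; simp
    · rintro ⟨-, h, -⟩; simpa using h
  | succ n ih =>
    simp only [leaves, Finset.mem_biUnion]
    constructor
    · rintro ⟨v, hv, hw⟩
      obtain ⟨h1, h2, h3⟩ := ih.1 hv
      split_ifs at hw with hd
      · obtain ⟨y, -, rfl⟩ := Finset.mem_image.1 hw
        simp [hd, h3 hd]
      · obtain rfl := Finset.mem_singleton.1 hw
        exact ⟨h1, by omega, fun h => absurd h hd⟩
    · rintro ⟨h1, h2, h3⟩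
      -- A play that has ended by stage `n` is already a leaf there; any other leaf is a child of a
      -- live one.
      by_cases hw : w ∉ σ.dom ∧ w.length ≤ n
      · exact ⟨w, ih.2 ⟨h1, hw.2, fun h => absurd h hw.1⟩, by simp [hw.1]⟩
      · have hlen : w.length = n + 1 := by
          by_cases hd : w ∈ σ.dom
          · exact h3 hd
          · have : ¬ w.length ≤ n := fun h => hw ⟨hd, h⟩
            omega
        rcases List.eq_nil_or_concat' w with rfl | ⟨v, y, rfl⟩
        · simp at hlen
        · have hv : v ∈ σ.dom := by simpa using h1
          have hvn : v.length = n := by simpa using hlen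
          refine ⟨v, ih.2 ⟨Or.inr (σ.prefix_closed _ _ (List.dropLast_prefix v) hv), hvn.le,
            fun _ => hvn⟩, by simp [hv]⟩

theorem sum_leaves_succ (σ : Strategy Y Act) (n : ℕ) (f : List Y → ℝ) :
    open Classical in ∑ w ∈ σ.leaves (n + 1), f w =
      ∑ w ∈ σ.leaves n, if w ∈ σ.dom then ∑ y, f (w ++ [y]) else f w := by
  classical
  rw [leaves, Finset.sum_biUnion]
  · refine Finset.sum_congr rfl fun w _ => ?_
    split_ifs with h
    · rw [Finset.sum_image fun _ _ _ _ h => by simpa using h]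
    · simp
  · intro v hv w hw hvw
    have hv' := σ.mem_leaves.1 hv
    have hw' := σ.mem_leaves.1 hw
    -- A child determines its parent, and it has length `n + 1`, too long to be a leaf of stage `n`.
    rw [Function.onFun, Finset.disjoint_left]
    intro u hu hu'
    split_ifs at hu with h <;> split_ifs at hu' with h' <;>
      simp only [Finset.mem_image, Finset.mem_univ, true_and, Finset.mem_singleton] at hu hu'
    · obtain ⟨y, rfl⟩ := hu
      obtain ⟨y', hy⟩ := hu'
      exact hvw (List.append_inj_left' hy rfl).symm
    · obtain ⟨y, rfl⟩ := hu
      have := hw'.2.1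
      rw [← hu', List.length_append, hv'.2.2 h] at this
      simp at this
    · obtain ⟨y, rfl⟩ := hu'
      have := hv'.2.1
      rw [← hu, List.length_append, hw'.2.2 h'] at this
      simp at this
    · exact hvw (hu.symm.trans hu')

theorem isFinite_truncate (σ : Strategy Y Act) (l : ℕ) : (σ.truncate l).IsFinite :=
  (List.finite_length_le Y l).subset fun _ hw => (σ.mem_dom_truncate.1 hw).2

/-- Truncation at `l` still acts on words of length `l`, so it allows `l + 1` actions; hence the
shift. -/
theorem terminates_truncate (σ : Strategy Y Act) {l : ℕ} {w : List Y} :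
    (σ.truncate l).Terminates w ↔ w ≠ [] ∧ w ∈ σ.leaves (l + 1) := by
  rw [Terminates, mem_leaves, mem_dom_truncate, mem_dom_truncate]
  refine and_congr_right fun hw => ?_
  have := List.length_pos_iff.2 hw
  rw [List.length_dropLast]
  constructor
  · rintro ⟨⟨h1, h2⟩, h3⟩
    refine ⟨Or.inr h1, by omega, fun h => ?_⟩
    have : ¬ w.length ≤ l := fun h' => h3 ⟨h, h'⟩
    omega
  · rintro ⟨h1, h2, h3⟩
    refine ⟨⟨h1.resolve_left hw, by omega⟩, fun h => ?_⟩
    have := h3 h.1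
    omega

theorem nil_not_mem_leaves (σ : Strategy Y Act) (n : ℕ) : [] ∉ σ.leaves (n + 1) := by
  intro h
  have := (σ.mem_leaves.1 h).2.2 σ.act_nil_isSome
  simp at this

end Strategy

/-! ### Likelihoods on the tree and conditional uncertainty -/

section

variable {X Y Act : Type*} [Fintype Y]

/-- The probability, given the secret `x`, that `σ` observes `w`, before or at its end. -/
noncomputable def pathWeight (S : Mechanism X Y Act) (σ : Strategy Y Act) (x : X) (w : List Y) :
    ℝ :=
  ∏ i : Fin w.length, (σ.act (w.take i)).elim 0 (fun a => S.M a x (w.get i))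

variable (S : Mechanism X Y Act) (σ : Strategy Y Act)

@[simp] theorem pathWeight_nil (x : X) : pathWeight S σ x [] = 1 := by
  simp [pathWeight]

theorem pathWeight_append (x : X) (w : List Y) (y : Y) {a : Act} (ha : σ.act w = some a) :
    pathWeight S σ x (w ++ [y]) = pathWeight S σ x w * S.M a x y := by
  -- Indexing by naturals, with `v[i]?`, avoids the dependence of `Fin v.length` on the list.
  have key : ∀ v : List Y, pathWeight S σ x v = ∏ i ∈ Finset.range v.length,
      (σ.act (v.take i)).elim 0 (fun a => (v[i]?).elim 0 (S.M a x)) := by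
    intro v
    rw [Finset.prod_range, pathWeight]
    refine Finset.prod_congr rfl fun i _ => ?_
    simp
  rw [key, key, List.length_append, List.length_singleton, Finset.prod_range_succ]
  congr 1
  · refine Finset.prod_congr rfl fun i hi => ?_
    have hi' := Finset.mem_range.1 hi
    rw [List.take_append_of_le_length hi'.le, List.getElem?_append_left hi']
  · simp [ha]

theorem pathWeight_nonneg (x : X) (w : List Y) : 0 ≤ pathWeight S σ x w := by
  refine Finset.prod_nonneg fun i _ => ?_
  cases σ.act (w.take i) with
  | none => simp
  | some a => exact (S.stochastic a x).1 _

theorem sum_pathWeight_append (x : X) {w : List Y} (hw : w ∈ σ.dom) :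
    ∑ y, pathWeight S σ x (w ++ [y]) = pathWeight S σ x w := by
  obtain ⟨a, ha⟩ := Option.isSome_iff_exists.1 hw
  simp only [pathWeight_append S σ x w _ ha, ← Finset.mul_sum, (S.stochastic a x).2, mul_one]

theorem sum_pathWeight (x : X) (n : ℕ) : ∑ w ∈ σ.leaves n, pathWeight S σ x w = 1 := by
  classical
  induction n with
  | zero => simp [Strategy.leaves]
  | succ n ih =>
    rw [σ.sum_leaves_succ, ← ih]
    refine Finset.sum_congr rfl fun w _ => ?_
    split_ifs with h
    · convert sum_pathWeight_append S σ x h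
    · rfl

theorem pathWeight_truncate (x : X) {l : ℕ} {w : List Y} (hw : w.length ≤ l + 1) :
    pathWeight S (σ.truncate l) x w = pathWeight S σ x w := by
  refine Finset.prod_congr rfl fun i _ => ?_
  have : (w.take i).length ≤ l := by
    rw [List.length_take]
    have := i.2
    omega
  simp only [Strategy.truncate, if_pos this]

/-- Indistinguishability speaks only of finite strategies and complete plays; the truncation at `n`
makes `w` one. -/
theorem pathWeight_eq_of_indist {x x' : X} [Fintype X] (h : (indist S).r x x') {n : ℕ} {w : List Y}
    (hw : w ∈ σ.leaves (n + 1)) : pathWeight S σ x w = pathWeight S σ x' w := by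
  have ht : (σ.truncate n).Terminates w :=
    σ.terminates_truncate.2 ⟨fun h => σ.nil_not_mem_leaves n (h ▸ hw), hw⟩
  have := congrFun (h _ (σ.isFinite_truncate n)) w
  rw [likelihood, likelihood, if_pos ht, if_pos ht] at this
  have hlen := (σ.mem_leaves.1 hw).2.1
  rw [← pathWeight_truncate S σ x hlen, ← pathWeight_truncate S σ x' hlen]
  exact this

theorem indist_of_forall_eq [Fintype X] {x x' : X} (h : ∀ a, S.M a x = S.M a x') :
    (indist S).r x x' := by
  intro σ _
  funext w
  simp only [likelihood, h]

/-- The positivity condition can be dropped because `perspective` vanishes at zero mass, whatever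
`U` is at the junk posterior. -/
theorem condUncertainty_eq_finsum [Fintype X] (U : (X → ℝ) → ℝ) {p : X → ℝ} (hp : 0 ≤ p) :
    condUncertainty S U p σ = ∑ᶠ w, perspective U fun x => joint S p σ x w := by
  refine finsum_congr fun w => ?_
  have hnn : 0 ≤ fun x => joint S p σ x w := fun x => by
    refine mul_nonneg (hp x) ?_
    rw [likelihood]
    split_ifs
    · exact pathWeight_nonneg S σ x w
    · exact le_rfl
  by_cases h : 0 < obsProb S p σ w
  · simp only [h, finsum_true]
    rfl
  · have h0 : ∑ x, joint S p σ x w = 0 :=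
      le_antisymm (not_lt.1 h) (Finset.sum_nonneg fun x _ => hnn x)
    simp only [h, finsum_false]
    rw [perspective, h0, zero_mul]

theorem condUncertainty_truncate [Fintype X] (U : (X → ℝ) → ℝ) {p : X → ℝ} (hp : 0 ≤ p) (l : ℕ) :
    condUncertainty S U p (σ.truncate l) =
      ∑ w ∈ σ.leaves (l + 1), perspective U fun x => p x * pathWeight S σ x w := by
  rw [condUncertainty_eq_finsum S _ U hp, finsum_eq_sum_of_support_subset (s := σ.leaves (l + 1))]
  · refine Finset.sum_congr rfl fun w hw => ?_
    have ht : (σ.truncate l).Terminates w :=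
      σ.terminates_truncate.2 ⟨fun h => σ.nil_not_mem_leaves l (h ▸ hw), hw⟩
    congr 1
    funext x
    rw [← pathWeight_truncate S σ x (σ.mem_leaves.1 hw).2.1, joint, likelihood, if_pos ht]
    rfl
  · intro w hw
    by_contra hmem
    refine hw ?_
    have ht : ¬ (σ.truncate l).Terminates w := fun h => hmem (σ.terminates_truncate.1 h).2
    simp only [joint, likelihood, if_neg ht, mul_zero]
    exact perspective_zero U

end

/-! ### Auxiliary facts on cycling, fibres and Bhattacharyya sums -/

theorem Strategy.not_isFinite_cyclic {Y Act : Type*} [Nonempty Y] [Fintype Act] [Nonempty Act]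
    (e : Fin (Fintype.card Act) ≃ Act) : ¬ (Strategy.cyclic e : Strategy Y Act).IsFinite :=
  fun h => Set.infinite_univ (h.subset fun _ _ => rfl : (Set.univ : Set (List Y)).Finite)

theorem sum_indicator_fiber {X ι : Type*} [Fintype ι] (κ : X → ι) (q : X → ℝ) :
    ∑ c, (κ ⁻¹' {c}).indicator q = q := by
  classical
  funext x
  simp [Finset.sum_apply, Set.indicator_apply]

/-- The deficit in AM-GM at `y` is `(√(q y) - √(r y))² / 2`, positive wherever `q` and `r` differ.
-/
theorem sum_sqrt_mul_lt_one {Y : Type*} [Fintype Y] {q r : Y → ℝ} (hq : q ∈ stdSimplex ℝ Y) (hr : r ∈ stdSimplex ℝ Y)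
    (hne : q ≠ r) : ∑ y, √(q y * r y) < 1 := by
  have key : ∀ y, (q y + r y) / 2 - √(q y * r y) = (√(q y) - √(r y)) ^ 2 / 2 := fun y => by
    rw [Real.sqrt_mul (hq.1 y), sub_sq, Real.sq_sqrt (hq.1 y), Real.sq_sqrt (hr.1 y)]
    ring
  have hone : ∑ y, (q y + r y) / 2 = 1 := by
    rw [← Finset.sum_div, Finset.sum_add_distrib, hq.2, hr.2]
    norm_num
  obtain ⟨y, hy⟩ := Function.ne_iff.1 hne
  rw [← hone]
  refine Finset.sum_lt_sum (fun z _ => ?_) ⟨y, Finset.mem_univ y, ?_⟩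
  · rw [← sub_nonneg, key]
    positivity
  · have hsub : √(q y) - √(r y) ≠ 0 := fun h =>
      hy ((Real.sqrt_inj (hq.1 y) (hr.1 y)).1 (sub_eq_zero.1 h))
    rw [← sub_pos, key]
    positivity

theorem sum_sqrt_mul_le_one {Y : Type*} [Fintype Y] {q r : Y → ℝ} (hq : q ∈ stdSimplex ℝ Y) (hr : r ∈ stdSimplex ℝ Y) :
    ∑ y, √(q y * r y) ≤ 1 := by
  rcases eq_or_ne q r with rfl | hne
  · simp only [Real.sqrt_mul_self (hq.1 _), hq.2, le_refl]
  · exact (sum_sqrt_mul_lt_one hq hr hne).le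

/-! ### Affinity of two secrets under a strategy -/

section

variable {X Y Act : Type*} [Fintype Y] (S : Mechanism X Y Act) (σ : Strategy Y Act)

theorem mul_pathWeight_nonneg {p : X → ℝ} (hp : 0 ≤ p) (w : List Y) :
    0 ≤ fun x => p x * pathWeight S σ x w :=
  fun x => mul_nonneg (hp x) (pathWeight_nonneg S σ x w)

/-- The Bhattacharyya coefficient of the observations of the secrets `x` and `x'` when `σ` is
stopped after at most `n` actions. -/
noncomputable def affinity (x x' : X) (n : ℕ) : ℝ :=
  ∑ w ∈ σ.leaves n, √(pathWeight S σ x w * pathWeight S σ x' w)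

/-- All leaves at stage `n` are live and have length `n`, so they share one next action and its
coefficient factors out. -/
theorem affinity_cyclic_succ [Fintype Act] [Nonempty Act]
    (e : Fin (Fintype.card Act) ≃ Act) (x x' : X) (n : ℕ) {a : Act}
    (ha : a = e ⟨n % Fintype.card Act, Nat.mod_lt _ Fintype.card_pos⟩) :
    affinity S (Strategy.cyclic e) x x' (n + 1) =
      affinity S (Strategy.cyclic e) x x' n * ∑ y, √(S.M a x y * S.M a x' y) := by
  classical
  rw [affinity, Strategy.sum_leaves_succ, affinity, Finset.sum_mul]
  refine Finset.sum_congr rfl fun w hw => ?_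
  have hdom : w ∈ (Strategy.cyclic e : Strategy Y Act).dom := rfl
  have hlen : w.length = n := (Strategy.mem_leaves _).1 hw |>.2.2 hdom
  have hact : (Strategy.cyclic e : Strategy Y Act).act w = some a := by
    subst hlen ha
    rfl
  rw [if_pos hdom, Finset.mul_sum]
  refine Finset.sum_congr rfl fun y _ => ?_
  rw [pathWeight_append S _ x w y hact, pathWeight_append S _ x' w y hact, mul_mul_mul_comm,
    Real.sqrt_mul (mul_nonneg (pathWeight_nonneg _ _ _ _) (pathWeight_nonneg _ _ _ _))]

end

/-! ### Remaining uncertainty against class uncertainty -/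

section

variable {X Y Act : Type*} [Fintype X] [Fintype Y]

/-- The uncertainty about the secret that is left when its indistinguishability class is known. -/
noncomputable def classUncertainty (S : Mechanism X Y Act) (U : (X → ℝ) → ℝ) (p : X → ℝ) : ℝ :=
  ∑ᶠ c : Quotient (indist S), perspective U ((Quotient.mk (indist S) ⁻¹' {c}).indicator p)

theorem classInfo_eq (S : Mechanism X Y Act) (U : (X → ℝ) → ℝ) {p : X → ℝ} (hp : 0 ≤ p) :
    classInfo S U p = U p - classUncertainty S U p := by
  classical
  rw [classInfo, classUncertainty]
  congr 1
  refine finsum_congr fun c => ?_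
  have hsum : ∑ x, (Quotient.mk (indist S) ⁻¹' {c}).indicator p x = classProb S p c := by
    simp only [classProb, Set.indicator_apply, Set.mem_preimage, Set.mem_singleton_iff]
  by_cases h : 0 < classProb S p c
  · simp only [h, finsum_true]
    rw [perspective, hsum]
    congr 2
    funext x
    by_cases hx : Quotient.mk (indist S) x = c <;> simp [classPosterior, hx]
  · have h0 : classProb S p c = 0 := by
      refine le_antisymm (not_lt.1 h) ?_
      rw [← hsum]
      exact Finset.sum_nonneg fun x _ => Set.indicator_nonneg (fun _ _ => hp _) x
    simp only [h, finsum_false]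
    rw [perspective, hsum, h0, zero_mul]

/-- The uncertainty that is left when `σ` is stopped after at most `n` actions. -/
noncomputable def remainingUncertainty (S : Mechanism X Y Act) (U : (X → ℝ) → ℝ) (p : X → ℝ)
    (σ : Strategy Y Act) (n : ℕ) : ℝ :=
  ∑ w ∈ σ.leaves n, perspective U fun x => p x * pathWeight S σ x w

variable (S : Mechanism X Y Act) {U : (X → ℝ) → ℝ} {p : X → ℝ} (σ : Strategy Y Act)

theorem infoGain_truncate (hp : 0 ≤ p) (l : ℕ) :
    infoGain S U p (σ.truncate l) = U p - remainingUncertainty S U p σ (l + 1) := by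
  rw [infoGain, condUncertainty_truncate S σ U hp, remainingUncertainty]

theorem remainingUncertainty_antitone (hU : IsUncertainty U) (hp : 0 ≤ p) :
    Antitone (remainingUncertainty S U p σ) := by
  classical
  refine antitone_nat_of_succ_le fun n => ?_
  rw [remainingUncertainty, σ.sum_leaves_succ]
  refine Finset.sum_le_sum fun w _ => ?_
  split_ifs with h
  · refine (hU.sum_perspective_le _ _ fun y => mul_pathWeight_nonneg S σ hp _).trans_eq ?_
    congr 1
    funext x
    rw [Finset.sum_apply, ← Finset.mul_sum, sum_pathWeight_append S σ x h]
  · exact le_rfl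

/-- On `c` the path weight equals that of a representative. Homogeneity pulls this scalar out, and
the scalars sum to `1` over the leaves. -/
theorem sum_perspective_indicator_class (n : ℕ) (c : Quotient (indist S)) :
    ∑ w ∈ σ.leaves (n + 1), perspective U
        ((Quotient.mk (indist S) ⁻¹' {c}).indicator fun x => p x * pathWeight S σ x w) =
      perspective U ((Quotient.mk (indist S) ⁻¹' {c}).indicator p) := by
  rw [← one_mul (perspective U (Set.indicator _ p)), ← sum_pathWeight S σ c.out (n + 1),
    Finset.sum_mul]
  refine Finset.sum_congr rfl fun w hw => ?_
  rw [← perspective_smul]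
  congr 1
  funext x
  by_cases hx : Quotient.mk (indist S) x = c
  · have hrel : (indist S).r x c.out := Quotient.exact (hx.trans c.out_eq.symm)
    simp [hx, pathWeight_eq_of_indist S σ hrel hw, mul_comm]
  · simp [hx]

theorem classUncertainty_le (hU : IsUncertainty U) (hp : 0 ≤ p) (n : ℕ) :
    classUncertainty S U p ≤ remainingUncertainty S U p σ (n + 1) := by
  have := Fintype.ofFinite (Quotient (indist S))
  rw [classUncertainty, finsum_eq_sum_of_fintype,
    Finset.sum_congr rfl fun c _ => (sum_perspective_indicator_class S σ n c).symm,
    Finset.sum_comm]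
  refine Finset.sum_le_sum fun w _ => (hU.sum_perspective_le _ _ fun c =>
    Set.indicator_nonneg fun x _ => mul_pathWeight_nonneg S σ hp w x).trans_eq ?_
  rw [sum_indicator_fiber]

/-- The splitting estimate is applied at every leaf; its `ε` terms add up to `ε` because the leaf
vectors have total mass `1`. -/
theorem exists_remainingUncertainty_le [Nonempty X] (hU : IsUncertainty U)
    (hp : p ∈ stdSimplex ℝ X) {ε : ℝ} (hε : 0 < ε) : ∃ C, 0 ≤ C ∧ ∀ n,
      remainingUncertainty S U p σ (n + 1) ≤ classUncertainty S U p + ε +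
        C * ∑ x, ∑ x', {x' | ¬ (indist S).r x x'}.indicator
          (fun x' => √(p x * p x') * affinity S σ x x' (n + 1)) x' := by
  have := Fintype.ofFinite (Quotient (indist S))
  obtain ⟨C, hC0, hC⟩ := hU.exists_perspective_le_sum_indicator (Quotient.mk (indist S)) hε
  refine ⟨C, hC0, fun n => ?_⟩
  refine (Finset.sum_le_sum fun w _ => hC _ (mul_pathWeight_nonneg S σ hp.1 w)).trans_eq ?_
  rw [Finset.sum_add_distrib, Finset.sum_add_distrib, ← Finset.mul_sum, ← Finset.mul_sum]
  congr 1
  · congr 1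
    · rw [classUncertainty, finsum_eq_sum_of_fintype, Finset.sum_comm]
      exact Finset.sum_congr rfl fun c _ => sum_perspective_indicator_class S σ n c
    · rw [Finset.sum_comm]
      simp only [← Finset.mul_sum, sum_pathWeight, mul_one, hp.2]
  · congr 1
    rw [Finset.sum_comm]
    refine Finset.sum_congr rfl fun x _ => ?_
    rw [Finset.sum_comm]
    refine Finset.sum_congr rfl fun x' _ => ?_
    have hiff : Quotient.mk (indist S) x ≠ Quotient.mk (indist S) x' ↔ ¬ (indist S).r x x' :=
      not_congr Quotient.eq
    by_cases h : (indist S).r x x'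
    · have h' : Quotient.mk (indist S) x = Quotient.mk (indist S) x' := Quotient.sound h
      simp [h, h']
    · rw [Set.indicator_of_mem (show x' ∈ {x' | ¬ (indist S).r x x'} from h), affinity,
        Finset.mul_sum]
      refine Finset.sum_congr rfl fun w _ => ?_
      rw [Set.indicator_of_mem (show x' ∈ {x' | Quotient.mk (indist S) x ≠
        Quotient.mk (indist S) x'} from hiff.2 h)]
      rw [← Real.sqrt_mul (mul_nonneg (hp.1 x) (hp.1 x')), mul_mul_mul_comm]

end

/-! ### Convergence for the cyclic strategy -/

section

variable {X Y Act : Type*} [Fintype X] [Fintype Y] [Fintype Act] [Nonempty Act]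
  (S : Mechanism X Y Act) (e : Fin (Fintype.card Act) ≃ Act)

theorem tendsto_affinity_cyclic {x x' : X} (h : ¬ (indist S).r x x') :
    Filter.Tendsto (affinity S (Strategy.cyclic e) x x') Filter.atTop (nhds 0) := by
  obtain ⟨a, ha⟩ : ∃ a, S.M a x ≠ S.M a x' := by
    by_contra! hall
    exact h (indist_of_forall_eq S hall)
  set A := affinity S (Strategy.cyclic e) x x' with hA
  have hnn : ∀ n, 0 ≤ A n := fun n => Finset.sum_nonneg fun _ _ => Real.sqrt_nonneg _
  have hanti : Antitone A := antitone_nat_of_succ_le fun n => by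
    rw [hA, affinity_cyclic_succ S e x x' n rfl]
    exact mul_le_of_le_one_right (hnn n)
      (sum_sqrt_mul_le_one (S.stochastic _ x) (S.stochastic _ x'))
  have hlim := tendsto_atTop_ciInf hanti ⟨0, by rintro _ ⟨n, rfl⟩; exact hnn n⟩
  set L := ⨅ n, A n
  set r := ∑ y, √(S.M a x y * S.M a x' y)
  have hr : r < 1 := sum_sqrt_mul_lt_one (S.stochastic a x) (S.stochastic a x') ha
  -- These are the stages at which `a` is the next action.
  have hsub : Filter.Tendsto (fun j => Fintype.card Act * j + (e.symm a : ℕ))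
      Filter.atTop Filter.atTop :=
    Filter.tendsto_atTop_mono (fun j => (Nat.le_mul_of_pos_left j Fintype.card_pos).trans
      (Nat.le_add_right _ _)) Filter.tendsto_id
  have hstep : ∀ j, A (Fintype.card Act * j + (e.symm a : ℕ) + 1) =
      A (Fintype.card Act * j + (e.symm a : ℕ)) * r := fun j => by
    refine affinity_cyclic_succ S e x x' _ ?_
    rw [← Equiv.symm_apply_eq]
    ext
    simp [Nat.mod_eq_of_lt (e.symm a).2]
  have h1 := (hlim.comp hsub).mul_const r
  have h2 := hlim.comp ((Filter.tendsto_add_atTop_nat 1).comp hsub)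
  -- Both the stages before and after playing `a` have limit `L`, and `r < 1` then forces `L = 0`.
  have hLr : L = L * r := tendsto_nhds_unique h2 (h1.congr fun j => (hstep j).symm)
  have hL : L = 0 := by
    have : L * (1 - r) = 0 := by linarith
    exact (mul_eq_zero.1 this).resolve_right (by linarith)
  rwa [hL] at hlim

theorem tendsto_remainingUncertainty_cyclic [Nonempty X] {U : (X → ℝ) → ℝ}
    (hU : IsUncertainty U) {p : X → ℝ} (hp : p ∈ stdSimplex ℝ X) :
    Filter.Tendsto (fun n => remainingUncertainty S U p (Strategy.cyclic e) (n + 1))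
      Filter.atTop (nhds (classUncertainty S U p)) := by
  refine tendsto_order.2 ⟨fun b hb => .of_forall fun n =>
    hb.trans_le (classUncertainty_le S _ hU hp.1 n), fun b hb => ?_⟩
  obtain ⟨C, -, hC⟩ := exists_remainingUncertainty_le S (Strategy.cyclic e) hU hp
    (half_pos (sub_pos.2 hb))
  have hlim : Filter.Tendsto (fun n => classUncertainty S U p + (b - classUncertainty S U p) / 2 +
      C * ∑ x, ∑ x', {x' | ¬ (indist S).r x x'}.indicator
        (fun x' => √(p x * p x') * affinity S (Strategy.cyclic e) x x' (n + 1)) x')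
      Filter.atTop (nhds (classUncertainty S U p + (b - classUncertainty S U p) / 2 +
        C * ∑ _x : X, ∑ _x' : X, 0)) := by
    refine tendsto_const_nhds.add (tendsto_const_nhds.mul
      (tendsto_finsetSum _ fun x _ => tendsto_finsetSum _ fun x' _ => ?_))
    by_cases h : (indist S).r x x'
    · simp [h]
    · have := ((Filter.tendsto_add_atTop_iff_nat 1).2
        (tendsto_affinity_cyclic S e h)).const_mul √(p x * p x')
      simpa [h] using this
  have hlt : classUncertainty S U p + (b - classUncertainty S U p) / 2 +
      C * ∑ _x : X, ∑ _x' : X, (0 : ℝ) < b := by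
    simp only [Finset.sum_const_zero, mul_zero]
    linarith
  filter_upwards [hlim.eventually (gt_mem_nhds hlt)] with n hn
  exact (hC n).trans_lt hn

end

/-! ### Leakage of arbitrary and cyclic strategies -/

section

variable {X Y Act : Type*} [Fintype X] [Fintype Y] (S : Mechanism X Y Act) {U : (X → ℝ) → ℝ}
  {p : X → ℝ}

theorem infoGain_truncate_le_classInfo (hU : IsUncertainty U) (hp : 0 ≤ p) (σ : Strategy Y Act)
    (l : ℕ) : infoGain S U p (σ.truncate l) ≤ classInfo S U p := by
  rw [infoGain_truncate S σ hp, classInfo_eq S U hp]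
  exact sub_le_sub_left (classUncertainty_le S σ hU hp l) _

theorem tendsto_leakage (hU : IsUncertainty U) (hp : 0 ≤ p) {σ : Strategy Y Act}
    (hσ : ¬ σ.IsFinite) :
    Filter.Tendsto (fun l : ℕ => infoGain S U p (σ.truncate l)) Filter.atTop
      (nhds (leakage S U p σ)) := by
  rw [leakage, if_neg hσ]
  -- `limUnder` is meaningful only if a limit exists; here the gains increase and are bounded by
  -- `classInfo`.
  refine tendsto_nhds_limUnder ⟨_, tendsto_atTop_ciSup (fun m n hmn => ?_)
    ⟨classInfo S U p, ?_⟩⟩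
  · rw [infoGain_truncate S σ hp, infoGain_truncate S σ hp]
    exact sub_le_sub_left (remainingUncertainty_antitone S σ hU hp (Nat.succ_le_succ hmn)) _
  · rintro _ ⟨l, rfl⟩
    exact infoGain_truncate_le_classInfo S hU hp σ l

theorem leakage_le_classInfo (hU : IsUncertainty U) (hp : 0 ≤ p) (σ : Strategy Y Act) :
    leakage S U p σ ≤ classInfo S U p := by
  by_cases hσ : σ.IsFinite
  -- A finite strategy equals one of its truncations, so the bound for truncations covers it.
  · obtain ⟨l, hl⟩ := hσ.exists_truncate_eq
    rw [leakage, if_pos hσ, ← hl]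
    exact infoGain_truncate_le_classInfo S hU hp σ l
  · exact le_of_tendsto' (tendsto_leakage S hU hp hσ)
      fun l => infoGain_truncate_le_classInfo S hU hp σ l

theorem leakage_cyclic [Nonempty X] [Nonempty Y] [Fintype Act] [Nonempty Act]
    (hU : IsUncertainty U) (hp : p ∈ stdSimplex ℝ X) (e : Fin (Fintype.card Act) ≃ Act) :
    leakage S U p (Strategy.cyclic e) = classInfo S U p := by
  refine tendsto_nhds_unique (tendsto_leakage S hU hp.1 (Strategy.not_isFinite_cyclic e)) ?_
  simp only [infoGain_truncate S _ hp.1, classInfo_eq S U hp.1]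
  exact tendsto_const_nhds.sub (tendsto_remainingUncertainty_cyclic S e hU hp)

end

end QIF

theorem theorem5p4 {X Y Act : Type*} [Fintype X] [Nonempty X] [Fintype Y] [Nonempty Y]
    [Fintype Act] [Nonempty Act] (S : QIF.Mechanism X Y Act)
    (U : (X → ℝ) → ℝ) (hU : QIF.IsUncertainty U) (p : X → ℝ) (hp : p ∈ stdSimplex ℝ X) :
    -- the limit that defines the leakage of an infinite strategy exists
    (∀ σ : QIF.Strategy Y Act, ¬ σ.IsFinite →
      Filter.Tendsto (fun l : ℕ => QIF.infoGain S U p (σ.truncate l)) Filter.atTop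
        (nhds (QIF.leakage S U p σ))) ∧
    -- cycling through all the actions, in any order, leaks `I(X;[X])`
    (∀ e : Fin (Fintype.card Act) ≃ Act,
      (QIF.Strategy.cyclic e : QIF.Strategy Y Act).IsTotal ∧
      (QIF.Strategy.cyclic e : QIF.Strategy Y Act).NonAdaptive ∧
      QIF.leakage S U p (QIF.Strategy.cyclic e) = QIF.classInfo S U p) ∧
    (∃ σ : QIF.Strategy Y Act, σ.IsTotal ∧ σ.NonAdaptive ∧
      QIF.leakage S U p σ = QIF.classInfo S U p) ∧
    -- the maximum leakage over all strategies is attained and equal to `I(X;[X])`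
    IsGreatest (Set.range fun σ : QIF.Strategy Y Act => QIF.leakage S U p σ)
      (QIF.classInfo S U p) ∧
    QIF.maxLeakage S U p = QIF.classInfo S U p := by
  have hcyc : ∀ e : Fin (Fintype.card Act) ≃ Act,
      (QIF.Strategy.cyclic e : QIF.Strategy Y Act).IsTotal ∧
      (QIF.Strategy.cyclic e : QIF.Strategy Y Act).NonAdaptive ∧
      QIF.leakage S U p (QIF.Strategy.cyclic e) = QIF.classInfo S U p := fun e =>
    ⟨Set.eq_univ_of_forall fun _ => rfl, fun v w h => by simp only [QIF.Strategy.cyclic, h],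
      QIF.leakage_cyclic S hU hp e⟩
  have hgreatest : IsGreatest (Set.range fun σ : QIF.Strategy Y Act => QIF.leakage S U p σ)
      (QIF.classInfo S U p) :=
    ⟨⟨_, (hcyc (Fintype.equivFin Act).symm).2.2⟩, by
      rintro _ ⟨σ, rfl⟩
      exact QIF.leakage_le_classInfo S hU hp.1 σ⟩
  exact ⟨fun σ hσ => QIF.tendsto_leakage S hU hp.1 hσ, hcyc, ⟨_, hcyc (Fintype.equivFin Act).symm⟩,
    hgreatest, hgreatest.csSup_eq⟩
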